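/- Let $\mathcal L^-$ be the language given by $$\varphi ::= p^l_i \mid p^r_i \mid \neg\varphi \mid \varphi\wedge\varphi \mid \Box\varphi \mid \blacksquare\varphi \qquad (i\in\mathbb N),$$ where the $p^l_i$ and the $p^r_i$ are two disjoint countable families of propositional variables. A model $\mathfrak M=(W,R,V)$ consists of a non-empty set $W$, a binary relation $R\subseteq W\times W$ and a valuation $V$ that assigns a subset of $W$ to each propositional variable. Truth at a pair of states $s,t\in W$ is defined by: $\mathfrak M,s,t\models p^l_i$ iff $s\in V(p^l_i)$; $\mathfrak M,s,t\models p^r_i$ iff $t\in V(p^r_i)$; the usual clauses for $\neg$ and $\wedge$; $\mathfrak M,s,t\models\Box\varphi$ iff $\mathfrak M,s',t\models\varphi$ for all $s'$ with $Rss'$; and $\mathfrak M,s,t\models\blacksquare\varphi$ iff $\mathfrak M,s,t'\models\varphi$ for all $t'$ with $Rtt'$. A formula is satisfiable if it is true at some pair of states of some model, and valid if it is true at all pairs of states of all models; $\mathsf{LHS}^-$ is the set of valid formulas of $\mathcal L^-$. Theorem. $\mathsf{LHS}^-$ has the finite model property: every satisfiable formula of $\mathcal L^-$ is true at some pair of states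 of some model with finite $W$, and, equivalently, every formula of $\mathcal L^-$ that is not valid is false at some pair of states of some model with finite $W$. Moreover, $\mathsf{LHS}^-$ is decidable: there is an algorithm that decides whether a given formula of $\mathcal L^-$ is satisfiable, and an algorithm that decides whether a given formula of $\mathcal L^-$ is valid. -/

import Mathlib

universe u

namespace LHSMinus

/-- Formulas of the language of `LHS⁻`: propositional variables `p^l_i` and `p^r_i` of the two
(disjoint, countable) kinds, negation, conjunction, the white box `□` and the black box `■`;
there is no equality constant. -/
inductive Formula : Type
  | pl : ℕ → Formula
  | pr : ℕ → Formula
  | neg : Formula → Formula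
  | and : Formula → Formula → Formula
  | wbox : Formula → Formula
  | bbox : Formula → Formula

namespace Formula

/-- The Gödel number of a formula. -/
def toNat : Formula → ℕ
  | pl i => 6 * i
  | pr i => 6 * i + 1
  | neg φ => 6 * φ.toNat + 2
  | and φ ψ => 6 * Nat.pair φ.toNat ψ.toNat + 3
  | wbox φ => 6 * φ.toNat + 4
  | bbox φ => 6 * φ.toNat + 5

/-- The formula with a given Gödel number. -/
def ofNat (n : ℕ) : Formula :=
  if n % 6 = 0 then pl (n / 6)
  else if n % 6 = 1 then pr (n / 6)
  else if n % 6 = 2 then neg (ofNat (n / 6))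
  else if n % 6 = 3 then and (ofNat (n / 6).unpair.1) (ofNat (n / 6).unpair.2)
  else if n % 6 = 4 then wbox (ofNat (n / 6))
  else bbox (ofNat (n / 6))
termination_by n
decreasing_by
  · omega
  · have := Nat.unpair_left_le (n / 6); omega
  · have := Nat.unpair_right_le (n / 6); omega
  · omega
  · omega

theorem ofNat_toNat (φ : Formula) : ofNat φ.toNat = φ := by
  induction φ with
  | pl i => rw [toNat, ofNat]; simp
  | pr i =>
    rw [toNat, ofNat]
    have h1 : (6 * i + 1) % 6 = 1 := by omega
    have h2 : (6 * i + 1) / 6 = i := by omega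
    simp [h1, h2]
  | neg φ ih =>
    rw [toNat, ofNat]
    have h1 : (6 * φ.toNat + 2) % 6 = 2 := by omega
    have h2 : (6 * φ.toNat + 2) / 6 = φ.toNat := by omega
    simp [h1, h2, ih]
  | and φ ψ ih1 ih2 =>
    rw [toNat, ofNat]
    have h1 : (6 * Nat.pair φ.toNat ψ.toNat + 3) % 6 = 3 := by omega
    have h2 : (6 * Nat.pair φ.toNat ψ.toNat + 3) / 6 = Nat.pair φ.toNat ψ.toNat := by omega
    simp [h1, h2, ih1, ih2]
  | wbox φ ih =>
    rw [toNat, ofNat]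
    have h1 : (6 * φ.toNat + 4) % 6 = 4 := by omega
    have h2 : (6 * φ.toNat + 4) / 6 = φ.toNat := by omega
    simp [h1, h2, ih]
  | bbox φ ih =>
    rw [toNat, ofNat]
    have h1 : (6 * φ.toNat + 5) % 6 = 5 := by omega
    have h2 : (6 * φ.toNat + 5) / 6 = φ.toNat := by omega
    simp [h1, h2, ih]

theorem toNat_ofNat (n : ℕ) : (ofNat n).toNat = n := by
  induction n using Nat.strong_induction_on with
  | _ n ih =>
    rw [ofNat]
    split_ifs with h0 h1 h2 h3 h4
    · rw [toNat]; omega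
    · rw [toNat]; omega
    · rw [toNat, ih _ (by omega)]; omega
    · have hl := Nat.unpair_left_le (n / 6)
      have hr := Nat.unpair_right_le (n / 6)
      rw [toNat, ih _ (by omega), ih _ (by omega), Nat.pair_unpair]; omega
    · rw [toNat, ih _ (by omega)]; omega
    · rw [toNat, ih _ (by omega)]; omega

/-- The Gödel numbering as a bijection between formulas and natural numbers. -/
def equivNat : Formula ≃ ℕ where
  toFun := toNat
  invFun := ofNat
  left_inv := ofNat_toNat
  right_inv := toNat_ofNat

/-- Computability of sets of formulas (`ComputablePred`) refers to the Gödel numbering above. -/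
instance : Primcodable Formula := Primcodable.ofEquiv ℕ equivNat

end Formula

/-- A model: a nonempty set of states, a binary relation, and a valuation of the variables
`p^l_i` (written `Sum.inl i`) and `p^r_i` (written `Sum.inr i`) as sets of states. -/
structure Model : Type (u + 1) where
  W : Type u
  nonempty : Nonempty W
  R : W → W → Prop
  V : ℕ ⊕ ℕ → Set W

/-- Truth of a formula at a pair of states. -/
def Model.Truth (M : Model.{u}) : M.W → M.W → Formula → Prop
  | s, _, .pl i => s ∈ M.V (Sum.inl i)
  | _, t, .pr i => t ∈ M.V (Sum.inr i)
  | s, t, .neg φ => ¬ M.Truth s t φ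
  | s, t, .and φ ψ => M.Truth s t φ ∧ M.Truth s t ψ
  | s, t, .wbox φ => ∀ s', M.R s s' → M.Truth s' t φ
  | s, t, .bbox φ => ∀ t', M.R t t' → M.Truth s t' φ

/-- `φ` is true at some pair of states of some model. -/
def Satisfiable (φ : Formula) : Prop :=
  ∃ (M : Model.{u}) (s t : M.W), M.Truth s t φ

/-- `φ` is true at all pairs of states of all models. -/
def Valid (φ : Formula) : Prop :=
  ∀ (M : Model.{u}) (s t : M.W), M.Truth s t φ

end LHSMinus

namespace LHSMinus

open Formula

/-! A pair of states is seen through its two coordinates separately, since each box moves one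
coordinate and leaves the other fixed. So truth of a formula depends on each coordinate only up to
bounded depth and finitely many variables, and for these there are finitely many bisimulation types
of trees. Ackermann-style, each type is coded by a number holding a mask of variables and a mask of
successor codes; all codes live in the single model `codeModel`. Replacing states by their codes
preserves truth (`Model.codeModel_truth_code`).

Codes decrease along the relation, so initial segments of `codeModel` are closed under successors
and give finite models. The codes have an explicit bound, and truth in `codeModel` is primitive
recursive, so satisfiability is a bounded search; validity of a formula is unsatisfiability of its
negation. -/

/-! ### The universal model and its finite initial segments -/

/-- The universal model: a natural number codes a state as the pair of the bit mask of the variables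
true at it (indexed by Gödel numbers) and the bit mask of its successors. -/
def codeModel : Model.{0} where
  W := ℕ
  nonempty := ⟨0⟩
  R s s' := s.unpair.2.testBit s' = true
  V
    | Sum.inl i => {s : ℕ | s.unpair.1.testBit (pl i).toNat = true}
    | Sum.inr i => {s : ℕ | s.unpair.1.testBit (pr i).toNat = true}

/-- The position of a set bit is smaller than the mask, which is at most the pair. This descent
underlies both the finite models and the recursion for truth. -/
theorem lt_of_codeModel_R {s s' : ℕ} (h : s.unpair.2.testBit s' = true) : s' < s :=
  (Nat.lt_two_pow_self.trans_le (Nat.ge_two_pow_of_testBit h)).trans_le (Nat.unpair_right_le s)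

/-- The restriction of `codeModel` to the states at most `b`. -/
def boundedCodeModel (b : ℕ) : Model.{u} where
  W := ULift.{u} (Fin (b + 1))
  nonempty := ⟨⟨0⟩⟩
  R s s' := codeModel.R s.down.val s'.down.val
  V i := {s | s.down.val ∈ codeModel.V i}

theorem boundedCodeModel_truth (b : ℕ) (φ : Formula) (s t : (boundedCodeModel.{u} b).W) :
    (boundedCodeModel.{u} b).Truth s t φ ↔ codeModel.Truth s.down.val t.down.val φ := by
  induction φ generalizing s t with
  | pl i => rfl
  | pr i => rfl
  | neg φ ih => simp only [Model.Truth, ih]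
  | and φ ψ ih₁ ih₂ => simp only [Model.Truth, ih₁, ih₂]
  | wbox φ ih =>
    simp only [Model.Truth, ih]
    refine ⟨fun h (s' : ℕ) hs' => ?_, fun h s' hs' => h _ hs'⟩
    exact h ⟨⟨s', (lt_of_codeModel_R hs').trans s.down.isLt⟩⟩ hs'
  | bbox φ ih =>
    simp only [Model.Truth, ih]
    refine ⟨fun h (t' : ℕ) ht' => ?_, fun h t' ht' => h _ ht'⟩
    exact h ⟨⟨t', (lt_of_codeModel_R ht').trans t.down.isLt⟩⟩ ht'

/-! ### Codes of truncated unravellings -/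

/-- A strict bound for the codes of states up to depth `k` and variables of number less than `n`. -/
def codeBound (n : ℕ) : ℕ → ℕ
  | 0 => 1
  | k + 1 => 2 ^ (2 * (n + codeBound n k))

open Classical in
/-- The code of the unravelling of a model at a state, cut off at depth `k` and restricted to the
variables with Gödel number less than `n`. -/
noncomputable def Model.code (M : Model.{u}) (n : ℕ) : ℕ → M.W → ℕ
  | 0, _ => 0
  | k + 1, s => Nat.pair
      -- A variable reads only one coordinate, so evaluating at the diagonal pair is harmless. Bits
      -- at numbers of compound formulas are never read.
      (Nat.ofBits fun i : Fin n => decide (M.Truth s s (ofNat i)))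
      (Nat.ofBits fun c : Fin (codeBound n k) => decide (∃ s', M.R s s' ∧ M.code n k s' = c))

theorem Model.code_lt (M : Model.{u}) (n k : ℕ) (s : M.W) : M.code n k s < codeBound n k := by
  classical
  cases k with
  | zero => simp [code, codeBound]
  | succ k =>
    rw [code, codeBound, mul_comm 2, pow_mul]
    -- Both masks lie below `2 ^ (n + codeBound n k)`, and a pair lies below the square of such a
    -- bound.
    refine (Nat.pair_lt_max_add_one_sq _ _).trans_le (Nat.pow_le_pow_left ?_ 2)
    refine Nat.succ_le_of_lt (max_lt ?_ ?_)
    · exact (Nat.ofBits_lt_two_pow _).trans_le (Nat.pow_le_pow_right two_pos (by omega))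
    · exact (Nat.ofBits_lt_two_pow _).trans_le (Nat.pow_le_pow_right two_pos (by omega))

theorem Model.testBit_code_fst (M : Model.{u}) {n k m : ℕ} (hm : m < n) (s : M.W) :
    (M.code n (k + 1) s).unpair.1.testBit m = true ↔ M.Truth s s (ofNat m) := by
  simp [code, hm]

/-- The successor mask has a bit for every possible code of depth `k`, by `code_lt`, so no successor
is lost. -/
theorem Model.codeModel_R_code (M : Model.{u}) {n k c : ℕ} (s : M.W) :
    codeModel.R (M.code n (k + 1) s) c ↔ ∃ s', M.R s s' ∧ M.code n k s' = c := by
  change (M.code n (k + 1) s).unpair.2.testBit c = true ↔ _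
  rw [code, Nat.unpair_pair, Nat.testBit_ofBits]
  split_ifs with h
  · simp
  · simp only [false_iff]
    rintro ⟨s', -, rfl⟩
    exact h (M.code_lt n k s')

/-- Passing to codes preserves truth of formulas whose Gödel number is below the cut-offs. -/
theorem Model.codeModel_truth_code (M : Model.{u}) {n : ℕ} (φ : Formula) (hn : φ.toNat < n)
    {j k : ℕ} (hj : φ.toNat < j) (hk : φ.toNat < k) (s t : M.W) :
    codeModel.Truth (M.code n j s) (M.code n k t) φ ↔ M.Truth s t φ := by
  induction φ generalizing j k s t with
  | pl i =>
    -- The strict bound forces positive depth; codes of depth zero record no variables.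
    obtain ⟨j, rfl⟩ := Nat.exists_eq_succ_of_ne_zero (Nat.ne_zero_of_lt hj)
    exact (M.testBit_code_fst hn s).trans (by rw [ofNat_toNat]; rfl)
  | pr i =>
    obtain ⟨k, rfl⟩ := Nat.exists_eq_succ_of_ne_zero (Nat.ne_zero_of_lt hk)
    exact (M.testBit_code_fst hn t).trans (by rw [ofNat_toNat]; rfl)
  | neg φ ih =>
    rw [Formula.toNat] at hn hj hk
    simp only [Model.Truth]
    rw [ih (by omega) (by omega) (by omega)]
  | and φ ψ ih₁ ih₂ =>
    rw [Formula.toNat] at hn hj hk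
    have h₁ := Nat.left_le_pair φ.toNat ψ.toNat
    have h₂ := Nat.right_le_pair φ.toNat ψ.toNat
    simp only [Model.Truth]
    rw [ih₁ (by omega) (by omega) (by omega), ih₂ (by omega) (by omega) (by omega)]
  | wbox φ ih =>
    rw [Formula.toNat] at hn hj hk
    -- Only the moving coordinate loses a level, which the smaller Gödel number of the subformula
    -- pays for.
    obtain ⟨j, rfl⟩ := Nat.exists_eq_succ_of_ne_zero (Nat.ne_zero_of_lt hj)
    simp only [Model.Truth, Nat.succ_eq_add_one]
    constructor
    · intro h s' hs'
      exact (ih (by omega) (by omega) (by omega) s' t).1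
        (h _ ((M.codeModel_R_code s).2 ⟨s', hs', rfl⟩))
    · intro h c hc
      obtain ⟨s', hs', rfl⟩ := (M.codeModel_R_code s).1 hc
      exact (ih (by omega) (by omega) (by omega) s' t).2 (h s' hs')
  | bbox φ ih =>
    rw [Formula.toNat] at hn hj hk
    obtain ⟨k, rfl⟩ := Nat.exists_eq_succ_of_ne_zero (Nat.ne_zero_of_lt hk)
    simp only [Model.Truth, Nat.succ_eq_add_one]
    constructor
    · intro h t' ht'
      exact (ih (by omega) (by omega) (by omega) s t').1
        (h _ ((M.codeModel_R_code t).2 ⟨t', ht', rfl⟩))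
    · intro h c hc
      obtain ⟨t', ht', rfl⟩ := (M.codeModel_R_code t).1 hc
      exact (ih (by omega) (by omega) (by omega) s t').2 (h t' ht')

/-! ### Finite model property -/

/-- A bound for the states of `codeModel` at which a formula has to be tested. -/
def searchBound (m : ℕ) : ℕ := codeBound (m + 1) (m + 1)

theorem Satisfiable.exists_code {φ : Formula} (h : Satisfiable.{u} φ) :
    ∃ s < searchBound φ.toNat, ∃ t < searchBound φ.toNat, codeModel.Truth s t φ := by
  obtain ⟨M, s, t, h⟩ := h
  -- The Gödel number bounds both the modal depth and the numbers of the variables, so its successor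
  -- serves for all cut-offs.
  have hlt := Nat.lt_succ_self φ.toNat
  exact ⟨_, M.code_lt _ _ s, _, M.code_lt _ _ t, (M.codeModel_truth_code φ hlt hlt hlt s t).2 h⟩

theorem exists_finite_of_codeModel_truth {φ : Formula} {s t : ℕ} (h : codeModel.Truth s t φ) :
    ∃ (M : Model.{u}) (s t : M.W), Finite M.W ∧ M.Truth s t φ :=
  ⟨boundedCodeModel (max s t), ⟨⟨s, by omega⟩⟩, ⟨⟨t, by omega⟩⟩,
    inferInstanceAs (Finite (ULift (Fin _))), (boundedCodeModel_truth _ _ _ _).2 h⟩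

theorem Satisfiable.exists_finite {φ : Formula} (h : Satisfiable.{u} φ) :
    ∃ (M : Model.{u}) (s t : M.W), Finite M.W ∧ M.Truth s t φ :=
  let ⟨_, _, _, _, h⟩ := h.exists_code
  exists_finite_of_codeModel_truth h

theorem satisfiable_iff_exists_code (φ : Formula) :
    Satisfiable.{u} φ ↔
      ∃ s < searchBound φ.toNat, ∃ t < searchBound φ.toNat, codeModel.Truth s t φ :=
  ⟨Satisfiable.exists_code, fun ⟨_, _, _, _, h⟩ =>
    let ⟨M, s, t, _, h⟩ := exists_finite_of_codeModel_truth h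
    ⟨M, s, t, h⟩⟩

theorem valid_iff_not_satisfiable_neg (φ : Formula) : Valid.{u} φ ↔ ¬ Satisfiable.{u} (neg φ) := by
  simp [Valid, Satisfiable, Model.Truth]

/-! ### Primitive recursiveness of truth in the universal model -/

theorem primrec_two_pow : Primrec fun n : ℕ => 2 ^ n :=
  (Primrec.nat_rec₁ 1 (Primrec.nat_double.comp Primrec.snd).to₂).of_eq fun n => by
    induction n with
    | zero => rfl
    | succ n ih => rw [pow_succ']; exact congrArg (2 * ·) ih

theorem primrec_searchBound : Primrec searchBound := by
  have h : Primrec₂ fun (m : ℕ) (p : ℕ × ℕ) => 2 ^ (2 * (m + 1 + p.2)) :=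
    primrec_two_pow.comp (Primrec.nat_double.comp
      (Primrec.nat_add.comp (Primrec.succ.comp Primrec.fst) (Primrec.snd.comp Primrec.snd)))
  refine (Primrec.nat_rec' Primrec.succ (Primrec.const 1) h).of_eq fun m => ?_
  suffices ∀ k, Nat.rec (motive := fun _ => ℕ) 1 (fun _ b => 2 ^ (2 * (m + 1 + b))) k =
    codeBound (m + 1) k from this (m + 1)
  intro k
  induction k with
  | zero => rfl
  | succ k ih => rw [codeBound, ← ih]

theorem primrecPred_testBit {α : Type*} [Primcodable α] {f g : α → ℕ} (hf : Primrec f)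
    (hg : Primrec g) : PrimrecPred fun a => (f a).testBit (g a) = true :=
  (Primrec.eq.comp (Primrec.nat_mod.comp (Primrec.nat_div.comp hf (primrec_two_pow.comp hg))
    (Primrec.const 2)) (Primrec.const 1)).of_eq fun a => by
      simp [Nat.testBit_eq_decide_div_mod_eq]

/-- Truth in `codeModel`, with the formula and both states packed into one number. -/
def CodeTruth (x : ℕ) : Prop :=
  codeModel.Truth x.unpair.2.unpair.1 x.unpair.2.unpair.2 (ofNat x.unpair.1)

theorem codeTruth_pair (n s t : ℕ) :
    CodeTruth (Nat.pair n (Nat.pair s t)) ↔ codeModel.Truth s t (ofNat n) := by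
  simp [CodeTruth]

/-- The recursive clauses of `CodeTruth`, where `l` lists the truth values at smaller arguments. -/
def CodeTruthStep (n s t : ℕ) (l : List Bool) : Prop :=
  (n % 6 = 0 ∧ s.unpair.1.testBit n = true) ∨
  (n % 6 = 1 ∧ t.unpair.1.testBit n = true) ∨
  (n % 6 = 2 ∧ ¬ l.getD (Nat.pair (n / 6) (Nat.pair s t)) false = true) ∨
  (n % 6 = 3 ∧ l.getD (Nat.pair (n / 6).unpair.1 (Nat.pair s t)) false = true ∧
    l.getD (Nat.pair (n / 6).unpair.2 (Nat.pair s t)) false = true) ∨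
  (n % 6 = 4 ∧ ∀ s' ∈ List.range s, ¬ s.unpair.2.testBit s' = true ∨
    l.getD (Nat.pair (n / 6) (Nat.pair s' t)) false = true) ∨
  (n % 6 = 5 ∧ ∀ t' ∈ List.range t, ¬ t.unpair.2.testBit t' = true ∨
    l.getD (Nat.pair (n / 6) (Nat.pair s t')) false = true)

open Classical in
theorem getD_map_range_codeTruth {x y : ℕ} (h : y < x) :
    ((List.range x).map fun y => decide (CodeTruth y)).getD y false = true ↔ CodeTruth y := by
  simp [List.getD_eq_getElem?_getD, h]

-- Each recursive call lowers the formula number and raises neither state. Pairing is strictly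
-- monotone in each argument, so every lookup falls inside the list and the default `false` is never
-- used. Quantifying over smaller states suffices because successors are smaller.
open Classical in
theorem codeTruthStep_iff (n s t : ℕ) :
    CodeTruthStep n s t ((List.range (Nat.pair n (Nat.pair s t))).map
      fun y => decide (CodeTruth y)) ↔ codeModel.Truth s t (ofNat n) := by
  have key {m s' t' : ℕ} (hm : m < n) (hs : s' ≤ s) (ht : t' ≤ t) :
      ((List.range (Nat.pair n (Nat.pair s t))).map fun y => decide (CodeTruth y)).getD
        (Nat.pair m (Nat.pair s' t')) false = true ↔ codeModel.Truth s' t' (ofNat m) := by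
    rw [getD_map_range_codeTruth, codeTruth_pair]
    have hst : Nat.pair s' t' ≤ Nat.pair s t :=
      ((StrictMono.monotone fun _ _ h => Nat.pair_lt_pair_left t' h) hs).trans
        ((StrictMono.monotone fun _ _ h => Nat.pair_lt_pair_right s h) ht)
    exact (Nat.pair_lt_pair_left _ hm).trans_le
      ((StrictMono.monotone fun _ _ h => Nat.pair_lt_pair_right n h) hst)
  have hlt : n % 6 < 6 := Nat.mod_lt _ (by norm_num)
  have hle₁ := Nat.unpair_left_le (n / 6)
  have hle₂ := Nat.unpair_right_le (n / 6)
  have hdiv := Nat.div_add_mod n 6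
  unfold CodeTruthStep
  rw [ofNat]
  interval_cases h : n % 6
  · have hn : (pl (n / 6)).toNat = n := by rw [Formula.toNat]; omega
    have htruth : codeModel.Truth s t (pl (n / 6)) ↔ s.unpair.1.testBit n = true := by
      conv_rhs => rw [← hn]
      rfl
    simp [htruth]
  · have hn : (pr (n / 6)).toNat = n := by rw [Formula.toNat]; omega
    have htruth : codeModel.Truth s t (pr (n / 6)) ↔ t.unpair.1.testBit n = true := by
      conv_rhs => rw [← hn]
      rfl
    simp [htruth]
  · simp [Model.Truth, key (m := n / 6) (by omega) le_rfl le_rfl, -List.getD_eq_getElem?_getD]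
  · simp [Model.Truth, key (m := (n / 6).unpair.1) (by omega) le_rfl le_rfl,
      key (m := (n / 6).unpair.2) (by omega) le_rfl le_rfl, -List.getD_eq_getElem?_getD]
  · simp only [OfNat.ofNat_ne_zero, OfNat.ofNat_ne_one, false_and, false_or, Nat.reduceEqDiff,
      or_false, true_and, if_true, if_false, Model.Truth, List.mem_range]
    constructor
    · intro hs s' hs'
      have hlt := lt_of_codeModel_R hs'
      exact (key (by omega) hlt.le le_rfl).1 ((hs s' hlt).resolve_left (not_not_intro hs'))
    · intro hs s' hlt
      by_cases hs' : s.unpair.2.testBit s' = true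
      · exact Or.inr ((key (by omega) hlt.le le_rfl).2 (hs s' hs'))
      · exact Or.inl hs'
  · simp only [OfNat.ofNat_ne_zero, OfNat.ofNat_ne_one, false_and, false_or, Nat.reduceEqDiff,
      true_and, if_false, Model.Truth, List.mem_range]
    constructor
    · intro ht t' ht'
      have hlt := lt_of_codeModel_R ht'
      exact (key (by omega) le_rfl hlt.le).1 ((ht t' hlt).resolve_left (not_not_intro ht'))
    · intro ht t' hlt
      by_cases ht' : t.unpair.2.testBit t' = true
      · exact Or.inr ((key (by omega) le_rfl hlt.le).2 (ht t' ht'))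
      · exact Or.inl ht'

theorem primrecPred_codeTruthStep {α : Type*} [Primcodable α] {n s t : α → ℕ} {l : α → List Bool}
    (hn : Primrec n) (hs : Primrec s) (ht : Primrec t) (hl : Primrec l) :
    PrimrecPred fun a => CodeTruthStep (n a) (s a) (t a) (l a) := by
  have hmod (k : ℕ) : PrimrecPred fun a => n a % 6 = k :=
    Primrec.eq.comp (Primrec.nat_mod.comp hn (Primrec.const 6)) (Primrec.const k)
  have hdiv : Primrec fun a => n a / 6 := Primrec.nat_div.comp hn (Primrec.const 6)
  have hget {β : Type _} [Primcodable β] {f : β → List Bool} {i j k : β → ℕ} (hf : Primrec f)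
      (hi : Primrec i) (hj : Primrec j) (hk : Primrec k) : PrimrecPred fun b =>
        (f b).getD (Nat.pair (i b) (Nat.pair (j b) (k b))) false = true :=
    Primrec.eq.comp ((Primrec.list_getD false).comp hf
      (Primrec₂.natPair.comp hi (Primrec₂.natPair.comp hj hk))) (Primrec.const true)
  have hfst {f : α → ℕ} (hf : Primrec f) : Primrec fun a => (f a).unpair.1 :=
    Primrec.fst.comp (Primrec.unpair.comp hf)
  have hsnd {f : α → ℕ} (hf : Primrec f) : Primrec fun a => (f a).unpair.2 :=
    Primrec.snd.comp (Primrec.unpair.comp hf)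
  have hw : PrimrecRel fun (s' : ℕ) (a : α) => ¬ (s a).unpair.2.testBit s' = true ∨
      (l a).getD (Nat.pair (n a / 6) (Nat.pair s' (t a))) false = true :=
    (primrecPred_testBit ((hsnd hs).comp Primrec.snd) Primrec.fst).not.or
      (hget (hl.comp Primrec.snd) (hdiv.comp Primrec.snd) Primrec.fst (ht.comp Primrec.snd))
  have hb : PrimrecRel fun (t' : ℕ) (a : α) => ¬ (t a).unpair.2.testBit t' = true ∨
      (l a).getD (Nat.pair (n a / 6) (Nat.pair (s a) t')) false = true :=
    (primrecPred_testBit ((hsnd ht).comp Primrec.snd) Primrec.fst).not.or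
      (hget (hl.comp Primrec.snd) (hdiv.comp Primrec.snd) (hs.comp Primrec.snd) Primrec.fst)
  exact ((hmod 0).and (primrecPred_testBit (hfst hs) hn)).or <|
    ((hmod 1).and (primrecPred_testBit (hfst ht) hn)).or <|
    ((hmod 2).and (hget hl hdiv hs ht).not).or <|
    ((hmod 3).and ((hget hl (hfst hdiv) hs ht).and (hget hl (hsnd hdiv) hs ht))).or <|
    ((hmod 4).and (hw.forall_mem_list.comp (Primrec.list_range.comp hs) Primrec.id)).or <|
    (hmod 5).and (hb.forall_mem_list.comp (Primrec.list_range.comp ht) Primrec.id)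

theorem primrecPred_codeTruth : PrimrecPred CodeTruth := by
  classical
  -- In course-of-values recursion the length of the list of earlier values is the current argument.
  have hlen : Primrec fun p : Unit × List Bool => p.2.length :=
    Primrec.list_length.comp Primrec.snd
  have hfst := Primrec.fst.comp (Primrec.unpair.comp hlen)
  have hsnd := Primrec.unpair.comp (Primrec.snd.comp (Primrec.unpair.comp hlen))
  have hstep := primrecPred_codeTruthStep hfst (Primrec.fst.comp hsnd) (Primrec.snd.comp hsnd)
    Primrec.snd
  have h : Primrec₂ fun (_ : Unit) (x : ℕ) => decide (CodeTruth x) := by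
    refine Primrec.nat_strong_rec _ (Primrec.option_some.comp hstep.decide).to₂ fun _ x => ?_
    have := codeTruthStep_iff x.unpair.1 x.unpair.2.unpair.1 x.unpair.2.unpair.2
    simp only [Nat.pair_unpair] at this
    simp only [List.length_map, List.length_range, Option.some.injEq, decide_eq_decide]
    exact this
  exact ⟨inferInstance, h.comp (Primrec.const ()) Primrec.id⟩

/-! ### Decidability -/

theorem computablePred_satisfiable : ComputablePred fun φ : Formula => Satisfiable.{u} φ := by
  have htoNat : Primrec Formula.toNat := Primrec.of_equiv (e := equivNat)
  have hb : Primrec fun φ : Formula => List.range (searchBound φ.toNat) :=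
    Primrec.list_range.comp (primrec_searchBound.comp htoNat)
  have h₁ : PrimrecRel fun (t : ℕ) (p : ℕ × Formula) =>
      CodeTruth (Nat.pair p.2.toNat (Nat.pair p.1 t)) :=
    primrecPred_codeTruth.comp (Primrec₂.natPair.comp
      (htoNat.comp (Primrec.snd.comp Primrec.snd))
      (Primrec₂.natPair.comp (Primrec.fst.comp Primrec.snd) Primrec.fst))
  have h₂ : PrimrecRel fun (s : ℕ) (φ : Formula) => ∃ t ∈ List.range (searchBound φ.toNat),
      CodeTruth (Nat.pair φ.toNat (Nat.pair s t)) :=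
    h₁.exists_mem_list.comp (hb.comp Primrec.snd) Primrec.id
  obtain ⟨hd, h⟩ := (h₂.exists_mem_list.comp hb Primrec.id).of_eq
    (q := fun φ : Formula => Satisfiable.{u} φ) fun φ => by
      simp only [List.mem_range, id, codeTruth_pair, ofNat_toNat]
      exact (satisfiable_iff_exists_code φ).symm
  exact ⟨hd, h.to_comp⟩

theorem computablePred_valid : ComputablePred fun φ : Formula => Valid.{u} φ := by
  have htoNat : Primrec Formula.toNat := Primrec.of_equiv (e := equivNat)
  -- On Gödel numbers negation is `n ↦ 6 * n + 2`.
  have hneg : Primrec neg := (Primrec.of_equiv_iff equivNat).1 <|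
    Primrec.nat_add.comp (Primrec.nat_mul.comp (Primrec.const 6) htoNat) (Primrec.const 2)
  have h : ComputablePred fun φ : Formula => Satisfiable.{u} (neg φ) :=
    ComputablePred.computable_of_manyOneReducible
      ⟨neg, hneg.to_comp, fun _ => Iff.rfl⟩ computablePred_satisfiable.{u}
  simpa only [valid_iff_not_satisfiable_neg] using h.not

theorem exists_finite_of_not_valid {φ : Formula} (h : ¬ Valid.{u} φ) :
    ∃ (M : Model.{u}) (s t : M.W), Finite M.W ∧ ¬ M.Truth s t φ :=
  Satisfiable.exists_finite (not_not.1 (mt (valid_iff_not_satisfiable_neg φ).2 h))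

end LHSMinus

/-- `LHS⁻` has the finite model property (every satisfiable formula is satisfied in a finite model,
and every non-valid formula is refuted in a finite model), and its satisfiability and validity
problems are decidable. -/
theorem mainTheorem4 :
    ((∀ φ : LHSMinus.Formula, LHSMinus.Satisfiable.{u} φ →
        ∃ (M : LHSMinus.Model.{u}) (s t : M.W), Finite M.W ∧ M.Truth s t φ) ∧
      (∀ φ : LHSMinus.Formula, ¬ LHSMinus.Valid.{u} φ →
        ∃ (M : LHSMinus.Model.{u}) (s t : M.W), Finite M.W ∧ ¬ M.Truth s t φ)) ∧
    ComputablePred (fun φ : LHSMinus.Formula => LHSMinus.Satisfiable.{u} φ) ∧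
    ComputablePred (fun φ : LHSMinus.Formula => LHSMinus.Valid.{u} φ) :=
  ⟨⟨fun _ h => h.exists_finite, fun _ h => LHSMinus.exists_finite_of_not_valid h⟩,
    LHSMinus.computablePred_satisfiable, LHSMinus.computablePred_valid⟩
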